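/- Let $X$ be a Polish space with Borel $\sigma$-algebra $\mathcal B_X$. Let $\Omega=C([0,\infty)\to X)$ carry the compact-open topology and its Borel $\sigma$-algebra $\mathcal F$. For $x\in X$ put $\Omega_x=\{w\in\Omega: w(0)=x\}$, and for $s\ge 0$ let $(\theta_s w)(t)=w(s+t)$. Let $\mathscr P$ be the set of probability measures on $(\Omega,\mathcal F)$ with the topology of weak convergence (tested on the set $C_b(\Omega)$ of bounded continuous real functions on $\Omega$). Write $Pf=\int_\Omega f\,dP$, and let $\theta_sP$ be the push-forward of $P$ under $\theta_s$. Let $\Phi$ be a countable set of bounded continuous functions $X\to\mathbb R$ that is closed under multiplication and strongly separates points: for every $x\in X$ and every neighbourhood $U$ of $x$ there are a finite set $F\subset\Phi$ and $\varepsilon>0$ such that for each $y\notin U$ some $\varphi\in F$ satisfies $|\varphi(y)-\varphi(x)|\ge\varepsilon$. Let $\Lambda$ be a countable dense subset of $(0,\infty)$. For $\lambda\in\Lambda$, $\varphi\in\Phi$, $s>0$ and $P\in\mathscr P$ put $$\zeta^s_{\lambda,\varphi}(P)=\int_0^s e^{-\lambda t}\int_\Omega\varphi(w(t))\,P(dw)\,dt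 .$$ For a set-valued map $\mathscr C:X\to 2^{\mathscr P}$, $x\in X$, $P\in\mathscr P$ and $s>0$ let $h_x[f]=\sup\{Pf:P\in\mathscr C(x)\}$ for $f\in C_b(\Omega)$, and $$K(P,s,\mathscr C)=\Big\{Q\in\mathscr P:\ Qf\le\int_\Omega h_{w(s)}[f]\,P(dw)\ \text{ for all } f\in C_b(\Omega)\Big\},$$ $$\Gamma[P,x,s](\mathscr C)=\big\{Q\in\mathscr C(x):\ \theta_sQ\in K(P,s,\mathscr C)\text{ and }\zeta^s_{\lambda,\varphi}(Q)\ge\zeta^s_{\lambda,\varphi}(P)\text{ for all }(\lambda,\varphi)\in\Lambda\times\Phi\big\}.$$ The map $\mathscr C$ is called a Krylov map if * (C1) $\mathscr C(x)$ is a non-empty compact convex subset of $\mathscr P$ for every $x\in X$; * (C2) $\{x\in X:\mathscr C(x)\cap M\ne\emptyset\}\in\mathcal B_X$ for every closed $M\subset\mathscr P$; * (C3) $P(\Omega_x)=1$ for every $x\in X$ and every $P\in\mathscr C(x)$; * (KP1) $\theta_sP\in K(P,s,\mathscr C)$ for all $x\in X$, $s>0$ and $P\in\mathscr C(x)$; *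 (KP2) $\theta_s\big(\Gamma[P,x,s](\mathscr C)\big)=K(P,s,\mathscr C)$ for all $x\in X$, $s>0$ and $P\in\mathscr C(x)$. **Theorem.** Every Krylov map $\mathscr C$ has a Markov selection, that is, a Borel measurable map $X\to\mathscr P$, $x\mapsto P_x$, such that $P_x\in\mathscr C(x)$ for every $x\in X$ and $$\theta_sP_x(A)=\int_\Omega P_{w(s)}(A)\,P_x(dw)\qquad\text{for all } x\in X,\ s>0,\ A\in\mathcal F .$$ -/

import Mathlib

open MeasureTheory Set
open scoped NNReal BoundedContinuousFunction

/-- The space `Ω = C([0,∞) → X)` of continuous paths, with the compact-open topology. -/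
abbrev PathSpace (X : Type*) [TopologicalSpace X] : Type _ := C(ℝ≥0, X)

namespace PathSpace

/-- Path space carries its Borel `σ`-algebra. -/
instance instMeasurableSpace (X : Type*) [TopologicalSpace X] :
    MeasurableSpace (PathSpace X) := borel _

instance instBorelSpace (X : Type*) [TopologicalSpace X] : BorelSpace (PathSpace X) := ⟨rfl⟩

/-- The shift on paths, `(θ_s w)(t) = w (s + t)`. -/
def shift {X : Type*} [TopologicalSpace X] (s : ℝ≥0) (w : PathSpace X) : PathSpace X :=
  w.comp ⟨fun t : ℝ≥0 => s + t, by fun_prop⟩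

theorem continuous_shift {X : Type*} [TopologicalSpace X] (s : ℝ≥0) :
    Continuous (shift (X := X) s) :=
  ContinuousMap.continuous_precomp _

/-- `θ_s P`: the push-forward of the probability measure `P` on path space under the shift. -/
noncomputable def shiftMeasure {X : Type*} [TopologicalSpace X] (s : ℝ≥0)
    (P : ProbabilityMeasure (PathSpace X)) : ProbabilityMeasure (PathSpace X) :=
  P.map (f := shift s) (continuous_shift s).measurable.aemeasurable

end PathSpace

/-- A family of bounded continuous functions strongly separates points: for every point `x` and
every neighbourhood `U` of `x`, finitely many functions of the family separate `x` uniformly from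
the complement of `U`. -/
def StronglySeparatesPoints {X : Type*} [TopologicalSpace X] (Φ : Set (X →ᵇ ℝ)) : Prop :=
  ∀ x : X, ∀ U ∈ nhds x, ∃ F : Finset (X →ᵇ ℝ), (F : Set (X →ᵇ ℝ)) ⊆ Φ ∧
    ∃ ε : ℝ, 0 < ε ∧ ∀ y ∉ U, ∃ φ ∈ F, ε ≤ |φ y - φ x|

section KrylovMaps

variable {X : Type*} [TopologicalSpace X]

/-- The support function `h_x[f] = sup {P f : P ∈ 𝒞(x)}`, for `f ∈ C_b(Ω)`. -/
noncomputable def supportFn (C : X → Set (ProbabilityMeasure (PathSpace X))) (x : X)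
    (f : PathSpace X →ᵇ ℝ) : ℝ :=
  sSup ((fun P : ProbabilityMeasure (PathSpace X) =>
    ∫ v, f v ∂(P : Measure (PathSpace X))) '' C x)

/-- The set `K(P, s, 𝒞)` of all probability measures `Q` on path space with
`Q f ≤ ∫ h_{w(s)}[f] P(dw)` for all `f ∈ C_b(Ω)`. -/
def krylovK (C : X → Set (ProbabilityMeasure (PathSpace X)))
    (P : ProbabilityMeasure (PathSpace X)) (s : ℝ≥0) : Set (ProbabilityMeasure (PathSpace X)) :=
  {Q | ∀ f : PathSpace X →ᵇ ℝ,
    ∫ v, f v ∂(Q : Measure (PathSpace X)) ≤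
      ∫ w, supportFn C (w s) f ∂(P : Measure (PathSpace X))}

/-- The truncated functional `ζ^s(P) = ∫_0^s e^{-λ t} ∫ φ(w(t)) P(dw) dt`. -/
noncomputable def zetaTrunc (lam : ℝ) (φ : X →ᵇ ℝ) (s : ℝ≥0)
    (P : ProbabilityMeasure (PathSpace X)) : ℝ :=
  ∫ t in (0 : ℝ)..(s : ℝ),
    Real.exp (-lam * t) * ∫ w, φ (w t.toNNReal) ∂(P : Measure (PathSpace X))

/-- The set `Γ[P, x, s](𝒞)` of all `Q ∈ 𝒞(x)` with `θ_s Q ∈ K(P, s, 𝒞)` and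
`ζ^s(Q) ≥ ζ^s(P)` for every pair `(λ, φ) ∈ Λ × Φ`. -/
def krylovGamma (Λ : Set ℝ) (Φ : Set (X →ᵇ ℝ))
    (C : X → Set (ProbabilityMeasure (PathSpace X)))
    (P : ProbabilityMeasure (PathSpace X)) (x : X) (s : ℝ≥0) :
    Set (ProbabilityMeasure (PathSpace X)) :=
  {Q | Q ∈ C x ∧ PathSpace.shiftMeasure s Q ∈ krylovK C P s ∧
    ∀ lam ∈ Λ, ∀ φ ∈ Φ, zetaTrunc lam φ s P ≤ zetaTrunc lam φ s Q}

/-- Krylov set-valued maps `𝒞 : X → 2^𝒫`, relative to the family of functionals indexed by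
`Λ × Φ`; the space `𝒫` of probability measures carries the topology of weak convergence. -/
structure IsKrylovMap [MeasurableSpace X] (Λ : Set ℝ) (Φ : Set (X →ᵇ ℝ))
    (C : X → Set (ProbabilityMeasure (PathSpace X))) : Prop where
  nonempty : ∀ x, (C x).Nonempty
  isCompact : ∀ x, IsCompact (C x)
  convex : ∀ x, Convex ℝ≥0
    ((fun P : ProbabilityMeasure (PathSpace X) => (P : Measure (PathSpace X))) '' C x)
  measurable : ∀ K : Set (ProbabilityMeasure (PathSpace X)), IsClosed K →
    MeasurableSet {x | (C x ∩ K).Nonempty}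
  supported : ∀ x, ∀ P ∈ C x, (P : Measure (PathSpace X)) {w | w 0 = x} = 1
  shift_mem : ∀ x, ∀ s : ℝ≥0, 0 < s → ∀ P ∈ C x,
    PathSpace.shiftMeasure s P ∈ krylovK C P s
  shift_image_gamma : ∀ x, ∀ s : ℝ≥0, 0 < s → ∀ P ∈ C x,
    PathSpace.shiftMeasure s '' krylovGamma Λ Φ C P x s = krylovK C P s

/-- Markov selections `x ↦ P_x` of a set-valued map `𝒞 : X → 2^𝒫`. Measurability is with respect
to the Borel `σ`-algebra of the topology of weak convergence on `𝒫`. -/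
structure IsMarkovSelection [MeasurableSpace X]
    (C : X → Set (ProbabilityMeasure (PathSpace X)))
    (p : X → ProbabilityMeasure (PathSpace X)) : Prop where
  measurable : Measurable[inferInstance, borel (ProbabilityMeasure (PathSpace X))] p
  mem : ∀ x, p x ∈ C x
  markov : ∀ x, ∀ s : ℝ≥0, 0 < s → ∀ A : Set (PathSpace X), MeasurableSet A →
    (PathSpace.shiftMeasure s (p x) : Measure (PathSpace X)) A =
      ∫⁻ w, (p (w s) : Measure (PathSpace X)) A ∂(p x : Measure (PathSpace X))

end KrylovMaps

/-!
The selection is Krylov's: among the measures in `𝒞(x)`, maximize successively the functionals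
`ζ(P) = ∫ z dP` with `z(w) = ∫_0^∞ e^{-λ t} φ(w(t)) dt`, for an enumeration of the pairs `(λ, φ)`.
The limit map `𝒟` turns out to have one-point values, and these form the Markov selection.

*One maximization step* (`IsWeakKrylov.maximizers`). Let `𝒞'(x)` be the set of maximizers of `ζ`
over `𝒞(x)`. All that is kept of the Krylov property is measurable compactness of the values, the
shift condition `θ_s P ∈ K(P, s, 𝒞)` for `P ∈ 𝒞(x)`, and the possibility of extending any
`Q ∈ K(P, s, 𝒞)` backwards to some `R ∈ 𝒞(x)` with `θ_s R = Q` and `ζ^s(R) ≥ ζ^s(P)`. The identity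
`ζ = ζ^s + e^{-λ s} ζ ∘ θ_s` (`integral_discountedFn_eq_add`) shows that for `P ∈ 𝒞'(x)` the
measure `θ_s P` must give `z` the integral `∫ h_{w(s)}[z] P(dw)`, the largest one possible in
`K(P, s, 𝒞)`: otherwise, a mixture of maximizers extended backwards would improve on `P`. By the
penalization `h[f + n z] - n h[z] → h'[f]`, where `h'` is the support function of `𝒞'`, such a
measure belongs to `K(P, s, 𝒞')` (`mem_krylovK_maximizers`). This replaces a disintegration of
`θ_s P` along the fibres.

*Measurability.* Maximizing a continuous function preserves measurability of a compact-valued map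
(`IsMeasurableCompactValued.argmaxSet`), and so does a decreasing intersection. The measurable
selection used in the mixture comes from the same two facts, applied to a sequence of functionals
that separates probability measures.

*One-point values.* All members of `𝒟(x)` share the values of all functionals, hence, by
uniqueness of Laplace transforms (`eq_of_forall_laplace_eq`) and since `Φ` determines measures on
`X`, their one-dimensional marginals. The condition `θ_s P ∈ K(P, s, 𝒟)` carries this over to all
finite-dimensional distributions (`integral_cylinderFn_eq`). For one-point values `{P_x}` the same
condition, tested with `f` and `-f`, is the Markov property.
-/

/-! ### Measurable selections of compact-valued maps -/

section Selection

open Filter Topology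

variable {X Y : Type*}

/-- The set-valued map of maximizers of `g` over the values of `C`. -/
def argmaxSet (C : X → Set Y) (g : Y → ℝ) (x : X) : Set Y :=
  {y ∈ C x | IsMaxOn g (C x) y}

theorem argmaxSet_subset (C : X → Set Y) (g : Y → ℝ) (x : X) : argmaxSet C g x ⊆ C x :=
  fun _ h => h.1

/-- The successive maximization of a sequence of functions over the values of `C`. -/
def iterArgmax (C : X → Set Y) (g : ℕ → Y → ℝ) : ℕ → X → Set Y
  | 0 => C
  | n + 1 => argmaxSet (iterArgmax C g n) (g n)

theorem iterArgmax_succ_subset (C : X → Set Y) (g : ℕ → Y → ℝ) (n : ℕ) (x : X) :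
    iterArgmax C g (n + 1) x ⊆ iterArgmax C g n x :=
  argmaxSet_subset _ _ _

/-- Each function of the sequence is constant on the values of the iterated maximization. -/
theorem eq_of_mem_iInter_iterArgmax {C : X → Set Y} {g : ℕ → Y → ℝ} {x : X} {y z : Y}
    (hy : y ∈ ⋂ n, iterArgmax C g n x) (hz : z ∈ ⋂ n, iterArgmax C g n x) (n : ℕ) :
    g n y = g n z := by
  have hy' := mem_iInter.mp hy (n + 1)
  have hz' := mem_iInter.mp hz (n + 1)
  exact le_antisymm (hz'.2 hy'.1) (hy'.2 hz'.1)

variable [MeasurableSpace X] [TopologicalSpace Y]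

/-- A set-valued map with non-empty compact values for which the set of points whose value meets
a given closed set is measurable. -/
structure IsMeasurableCompactValued (C : X → Set Y) : Prop where
  nonempty : ∀ x, (C x).Nonempty
  isCompact : ∀ x, IsCompact (C x)
  measurableSet : ∀ M : Set Y, IsClosed M → MeasurableSet {x | (C x ∩ M).Nonempty}

/-- The set of points `x` with `argmaxSet C g x ∩ M` non-empty is cut out by the countably many
conditions "if `g` reaches the rational level `a` on `C x`, it does so on `C x ∩ M`". -/
theorem IsMeasurableCompactValued.argmaxSet {C : X → Set Y} (hC : IsMeasurableCompactValued C)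
    {g : Y → ℝ} (hg : Continuous g) : IsMeasurableCompactValued (argmaxSet C g) where
  nonempty x := by
    obtain ⟨y, hy, hmax⟩ := (hC.isCompact x).exists_isMaxOn (hC.nonempty x) hg.continuousOn
    exact ⟨y, hy, hmax⟩
  isCompact x := by
    have h : _root_.argmaxSet C g x = C x ∩ ⋂ z ∈ C x, {y | g z ≤ g y} := by
      ext y
      simp [_root_.argmaxSet, isMaxOn_iff]
    rw [h]
    exact (hC.isCompact x).inter_right
      (isClosed_biInter fun z _ => isClosed_le continuous_const hg)
  measurableSet M hM := by
    have hlevel : ∀ a : ℝ, IsClosed {y | a ≤ g y} := fun a => isClosed_le continuous_const hg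
    have h : {x | (_root_.argmaxSet C g x ∩ M).Nonempty} = {x | (C x ∩ M).Nonempty} ∩
        ⋂ a : ℚ, ({x | (C x ∩ {y | (a : ℝ) ≤ g y}).Nonempty}ᶜ ∪
          {x | (C x ∩ (M ∩ {y | (a : ℝ) ≤ g y})).Nonempty}) := by
      ext x
      simp only [mem_ofPred_eq, mem_inter_iff, mem_iInter, mem_union, mem_compl_iff]
      constructor
      · rintro ⟨y, ⟨hy, hmax⟩, hyM⟩
        refine ⟨⟨y, hy, hyM⟩, fun a => ?_⟩
        by_cases ha : (C x ∩ {y | (a : ℝ) ≤ g y}).Nonempty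
        · obtain ⟨z, hz, haz⟩ := ha
          exact Or.inr ⟨y, hy, hyM, show (a : ℝ) ≤ g y from le_trans haz (hmax hz)⟩
        · exact Or.inl ha
      · rintro ⟨hne, hlev⟩
        obtain ⟨y, ⟨hy, hyM⟩, hmax⟩ :=
          ((hC.isCompact x).inter_right hM).exists_isMaxOn hne hg.continuousOn
        refine ⟨y, ⟨hy, fun z hz => ?_⟩, hyM⟩
        change g z ≤ g y
        by_contra hlt
        obtain ⟨a, hya, haz⟩ := exists_rat_btwn (not_le.mp hlt)
        rcases hlev a with h | ⟨u, hu, huM, hau⟩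
        · exact h ⟨z, hz, haz.le⟩
        · exact absurd (hmax ⟨hu, huM⟩) (not_le.mpr (lt_of_lt_of_le hya hau))
    rw [h]
    exact (hC.measurableSet M hM).inter (MeasurableSet.iInter fun a =>
      (hC.measurableSet _ (hlevel a)).compl.union (hC.measurableSet _ (hM.inter (hlevel a))))

theorem IsMeasurableCompactValued.iInter [T2Space Y] {C : ℕ → X → Set Y}
    (hC : ∀ n, IsMeasurableCompactValued (C n)) (hanti : ∀ n x, C (n + 1) x ⊆ C n x) :
    IsMeasurableCompactValued (fun x => ⋂ n, C n x) := by
  have key : ∀ (M : Set Y), IsClosed M → ∀ x, ((⋂ n, C n x) ∩ M).Nonempty ↔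
      ∀ n, (C n x ∩ M).Nonempty := by
    intro M hM x
    constructor
    · rintro ⟨y, hy, hyM⟩ n
      exact ⟨y, mem_iInter.mp hy n, hyM⟩
    · intro h
      rw [iInter_inter]
      exact IsCompact.nonempty_iInter_of_sequence_nonempty_isCompact_isClosed _
        (fun n => inter_subset_inter_left _ (hanti n x)) h (((hC 0).isCompact x).inter_right hM)
        (fun n => ((hC n).isCompact x).isClosed.inter hM)
  refine ⟨fun x => ?_, fun x => ?_, fun M hM => ?_⟩
  · have := (key univ isClosed_univ x).mpr fun n => by simpa using (hC n).nonempty x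
    simpa using this
  · exact ((hC 0).isCompact x).of_isClosed_subset
      (isClosed_iInter fun n => ((hC n).isCompact x).isClosed) (iInter_subset _ 0)
  · simp only [key M hM]
    rw [ofPred_forall]
    exact MeasurableSet.iInter fun n => (hC n).measurableSet M hM

theorem IsMeasurableCompactValued.iterArgmax {C : X → Set Y} (hC : IsMeasurableCompactValued C)
    {g : ℕ → Y → ℝ} (hg : ∀ n, Continuous (g n)) (n : ℕ) :
    IsMeasurableCompactValued (iterArgmax C g n) := by
  induction n with
  | zero => exact hC
  | succ n ih => exact ih.argmaxSet (hg n)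

theorem IsMeasurableCompactValued.measurable_of_subsingleton {C : X → Set Y}
    (hC : IsMeasurableCompactValued C) (hsub : ∀ x, (C x).Subsingleton) {p : X → Y}
    (hp : ∀ x, p x ∈ C x) : Measurable[inferInstance, borel Y] p := by
  borelize Y
  refine measurable_of_isClosed fun M hM => ?_
  convert hC.measurableSet M hM using 1
  ext x
  constructor
  · exact fun h => ⟨p x, hp x, h⟩
  · rintro ⟨y, hy, hyM⟩
    rw [hsub x hy (hp x)] at hyM
    exact hyM

/-- Successive maximization of a separating sequence of continuous functions selects a point. -/
theorem IsMeasurableCompactValued.exists_measurable_selection [T2Space Y] {C : X → Set Y}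
    (hC : IsMeasurableCompactValued C) {g : ℕ → Y → ℝ} (hg : ∀ n, Continuous (g n))
    (hsep : ∀ y z, (∀ n, g n y = g n z) → y = z) :
    ∃ p : X → Y, Measurable[inferInstance, borel Y] p ∧ ∀ x, p x ∈ C x := by
  have hD := IsMeasurableCompactValued.iInter (hC.iterArgmax hg)
    (iterArgmax_succ_subset C g)
  choose p hp using hD.nonempty
  exact ⟨p, hD.measurable_of_subsingleton
    (fun x y hy z hz => hsep y z (eq_of_mem_iInter_iterArgmax hy hz)) hp,
    fun x => mem_iInter.mp (hp x) 0⟩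

/-- The maximum of a continuous function over a decreasing sequence of compact sets converges to
its maximum over the intersection. -/
theorem tendsto_sSup_image_iInter [T2Space Y] {K : ℕ → Set Y} (hK : ∀ n, IsCompact (K n))
    (hne : ∀ n, (K n).Nonempty) (hanti : ∀ n, K (n + 1) ⊆ K n) {g : Y → ℝ} (hg : Continuous g) :
    Tendsto (fun n => sSup (g '' K n)) atTop (𝓝 (sSup (g '' ⋂ n, K n))) := by
  have hbdd : ∀ n, BddAbove (g '' K n) := fun n => ((hK n).image hg).bddAbove
  have hneI : (⋂ n, K n).Nonempty :=
    IsCompact.nonempty_iInter_of_sequence_nonempty_isCompact_isClosed _ hanti hne (hK 0)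
      fun n => (hK n).isClosed
  have hmono : Antitone K := antitone_nat_of_succ_le hanti
  have hKI : IsCompact (⋂ n, K n) :=
    (hK 0).of_isClosed_subset (isClosed_iInter fun n => (hK n).isClosed) (iInter_subset _ 0)
  rw [tendsto_order]
  refine ⟨fun a ha => Eventually.of_forall fun n => lt_of_lt_of_le ha ?_, fun a ha => ?_⟩
  · exact csSup_le_csSup (hbdd n) (hneI.image _) (image_mono (iInter_subset _ n))
  · by_contra hcon
    -- infinitely many, hence all, of the sets `K n` meet the closed set `{a ≤ g}`
    have hall : ∀ n, (K n ∩ {y | a ≤ g y}).Nonempty := by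
      intro n
      obtain ⟨m, hm, hlt⟩ := frequently_atTop.mp (not_eventually.mp hcon) n
      obtain ⟨y, hy, hmax⟩ := (hK m).exists_sSup_image_eq (hne m) hg.continuousOn
      exact ⟨y, hmono hm hy, by rw [mem_ofPred_eq, ← hmax]; exact not_lt.mp hlt⟩
    have hcl : IsClosed {y | a ≤ g y} := isClosed_le continuous_const hg
    obtain ⟨y, hy⟩ := IsCompact.nonempty_iInter_of_sequence_nonempty_isCompact_isClosed
      (fun n => K n ∩ {y | a ≤ g y}) (fun n => inter_subset_inter_left _ (hanti n)) hall
      ((hK 0).inter_right hcl) (fun n => (hK n).isClosed.inter hcl)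
    rw [← iInter_inter] at hy
    have := le_csSup (hKI.image hg).bddAbove (mem_image_of_mem g hy.1)
    exact absurd (lt_of_lt_of_le ha hy.2) (not_lt.mpr this)

/-- Penalization: the maximum of `f + n g`, corrected by `n` times the maximum of `g`, converges
to the maximum of `f` over the maximizers of `g`. -/
theorem tendsto_sSup_image_penalized {K : Set Y} (hK : IsCompact K) (hne : K.Nonempty)
    {f g : Y → ℝ} (hf : Continuous f) (hg : Continuous g) :
    Tendsto (fun n : ℕ => sSup ((fun y => f y + n * g y) '' K) - n * sSup (g '' K)) atTop
      (𝓝 (sSup (f '' {y ∈ K | IsMaxOn g K y}))) := by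
  have hle : ∀ y ∈ K, g y ≤ sSup (g '' K) := fun y hy =>
    le_csSup (hK.image hg).bddAbove (mem_image_of_mem g hy)
  have hcont : ∀ n : ℕ, Continuous fun y => f y + n * g y := fun n => by fun_prop
  obtain ⟨y₀, hy₀, hy₀max⟩ := hK.exists_isMaxOn hne hg.continuousOn
  have hmaxeq : ∀ y ∈ K, IsMaxOn g K y → g y = sSup (g '' K) := fun y hy hmax =>
    le_antisymm (hle y hy) (csSup_le (hne.image g) (by rintro _ ⟨z, hz, rfl⟩; exact hmax hz))
  have hbdd : BddAbove (f '' {y ∈ K | IsMaxOn g K y}) :=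
    (hK.image hf).bddAbove.mono (image_mono fun y hy => hy.1)
  rw [tendsto_order]
  refine ⟨fun a ha => Eventually.of_forall fun n => lt_of_lt_of_le ha ?_, fun a ha => ?_⟩
  · refine csSup_le ⟨_, mem_image_of_mem f (show y₀ ∈ {y ∈ K | IsMaxOn g K y} from
      ⟨hy₀, hy₀max⟩)⟩ ?_
    rintro _ ⟨y, ⟨hy, hmax⟩, rfl⟩
    have := le_csSup (hK.image (hcont n)).bddAbove (mem_image_of_mem (fun y => f y + n * g y) hy)
    simp only [hmaxeq y hy hmax] at this
    linarith
  · -- on the compact set `{a ≤ f}` the function `g` stays away from its maximum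
    have hcl : IsClosed {y | a ≤ f y} := isClosed_le continuous_const hf
    obtain ⟨B, hB⟩ := (hK.image hf).bddAbove
    have hgap : ∃ δ > 0, ∀ y ∈ K, a ≤ f y → g y + δ ≤ sSup (g '' K) := by
      rcases (K ∩ {y | a ≤ f y}).eq_empty_or_nonempty with hemp | hne'
      · refine ⟨1, one_pos, fun y hy hay => ?_⟩
        have : y ∈ K ∩ {y | a ≤ f y} := ⟨hy, hay⟩
        rw [hemp] at this
        exact this.elim
      · obtain ⟨z, ⟨hz, haz⟩, hzmax⟩ :=
          (hK.inter_right hcl).exists_isMaxOn hne' hg.continuousOn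
        refine ⟨sSup (g '' K) - g z, ?_, fun y hy hay => ?_⟩
        · rcases (hle z hz).lt_or_eq with h | h
          · exact sub_pos.mpr h
          · have hzm : IsMaxOn g K z := fun y hy => h ▸ hle y hy
            have := le_csSup hbdd (mem_image_of_mem f (show z ∈ {y ∈ K | IsMaxOn g K y} from
              ⟨hz, hzm⟩))
            exact absurd (lt_of_lt_of_le ha haz) (not_lt.mpr this)
        · have : g y ≤ g z := hzmax ⟨hy, hay⟩
          linarith
    obtain ⟨δ, hδ, hgapδ⟩ := hgap
    obtain ⟨N, hN⟩ := exists_nat_gt ((B - a) / δ)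
    filter_upwards [eventually_ge_atTop N] with n hn
    obtain ⟨y, hy, hyeq⟩ := hK.exists_sSup_image_eq hne (hcont n).continuousOn
    rw [hyeq]
    have hn0 : (0 : ℝ) ≤ n := n.cast_nonneg
    by_cases hay : a ≤ f y
    · have h1 : f y ≤ B := hB (mem_image_of_mem f hy)
      have h2 := mul_le_mul_of_nonneg_left (hgapδ y hy hay) hn0
      have h3 : B - a < n * δ := by
        rw [div_lt_iff₀ hδ] at hN
        have : (N : ℝ) ≤ n := by exact_mod_cast hn
        nlinarith
      nlinarith
    · have := mul_le_mul_of_nonneg_left (hle y hy) hn0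
      linarith [not_le.mp hay]

end Selection

/-! ### Determining classes of bounded continuous functions -/

section Determining

open Filter Topology

/-- Two finite measures on a Polish space agree if they integrate alike all members of a
multiplicative monoid of bounded continuous functions that separates points: by linearity they
integrate alike the members of the algebra it spans. -/
theorem ext_of_forall_mem_submonoid_integral_eq {E : Type*} [TopologicalSpace E] [PolishSpace E]
    [MeasurableSpace E] [BorelSpace E] {P P' : Measure E} [IsFiniteMeasure P] [IsFiniteMeasure P']
    (S : Submonoid (E →ᵇ ℝ)) (hsep : ∀ x y, (∀ f ∈ S, f x = f y) → x = y)
    (heq : ∀ f ∈ S, ∫ x, f x ∂P = ∫ x, f x ∂P') : P = P' := by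
  let A : StarSubalgebra ℝ (E →ᵇ ℝ) :=
    { Algebra.adjoin ℝ (S : Set (E →ᵇ ℝ)) with
      star_mem' := by
        intro a ha
        have : star a = a := by ext x; simp
        rw [this]
        exact ha }
  refine ext_of_forall_mem_subalgebra_integral_eq_of_polish (𝕜 := ℝ) (A := A) ?_ ?_
  · intro x y hxy
    by_contra hcon
    refine hxy (hsep x y fun f hf => ?_)
    by_contra hne
    exact hcon ⟨f, ⟨f.toContinuousMap, ⟨f, Algebra.subset_adjoin hf, rfl⟩, rfl⟩, hne⟩
  · intro g hg
    have hg' : g ∈ Submodule.span ℝ (S : Set (E →ᵇ ℝ)) := by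
      have h : g ∈ Subalgebra.toSubmodule (Algebra.adjoin ℝ (S : Set (E →ᵇ ℝ))) := hg
      rwa [Algebra.adjoin_eq_span, Submonoid.closure_eq] at h
    clear hg
    induction hg' using Submodule.span_induction with
    | mem f hf => exact heq f hf
    | zero => simp
    | add f g _ _ hf hg =>
      simp only [BoundedContinuousFunction.coe_add, Pi.add_apply]
      rw [integral_add (f.integrable _) (g.integrable _),
        integral_add (f.integrable _) (g.integrable _), hf, hg]
    | smul c f _ hf =>
      simp only [BoundedContinuousFunction.coe_smul, integral_smul]
      rw [hf]

/-! ### Uniqueness of Laplace transforms -/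

theorem integrableOn_exp_mul_boundedContinuous {lam : ℝ} (hlam : 0 < lam) (u : ℝ≥0 →ᵇ ℝ) :
    IntegrableOn (fun t : ℝ => Real.exp (-lam * t) * u t.toNNReal) (Ioi 0) := by
  refine (exp_neg_integrableOn_Ioi 0 hlam).mul_bdd (c := ‖u‖) ?_ ?_
  · exact (u.continuous.comp continuous_real_toNNReal).aestronglyMeasurable
  · exact ae_of_all _ fun t => u.norm_coe_le_norm _

theorem continuousOn_laplace (u : ℝ≥0 →ᵇ ℝ) :
    ContinuousOn (fun lam : ℝ => ∫ t in Ioi (0 : ℝ), Real.exp (-lam * t) * u t.toNNReal)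
      (Ioi 0) := by
  have hu : Continuous fun t : ℝ => u t.toNNReal := u.continuous.comp continuous_real_toNNReal
  have key : ∀ a : ℝ, 0 < a → ContinuousOn
      (fun lam : ℝ => ∫ t in Ioi (0 : ℝ), Real.exp (-lam * t) * u t.toNNReal) (Ioi a) := by
    intro a ha
    refine continuousOn_of_dominated (bound := fun t => Real.exp (-a * t) * ‖u‖) ?_ ?_ ?_ ?_
    · exact fun lam _ => Continuous.aestronglyMeasurable (by fun_prop)
    · intro lam hlam
      refine (ae_restrict_iff' measurableSet_Ioi).mpr (ae_of_all _ fun t ht => ?_)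
      rw [norm_mul, Real.norm_of_nonneg (Real.exp_pos _).le]
      have h1 : Real.exp (-lam * t) ≤ Real.exp (-a * t) := by
        apply Real.exp_le_exp.mpr
        have := mul_le_mul_of_nonneg_right (le_of_lt (mem_Ioi.mp hlam)) (le_of_lt (mem_Ioi.mp ht))
        linarith
      exact mul_le_mul h1 (u.norm_coe_le_norm _) (norm_nonneg _) (Real.exp_pos _).le
    · exact (exp_neg_integrableOn_Ioi 0 ha).mul_const _
    · exact ae_of_all _ fun t => Continuous.continuousOn (by fun_prop)
  intro lam hlam
  have hlam' : (0 : ℝ) < lam := hlam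
  exact ((key (lam / 2) (by positivity)).continuousAt
    (Ioi_mem_nhds (by linarith))).continuousWithinAt

/-- A bounded continuous function on `[0, ∞)` is determined by its Laplace transform on a dense set
of parameters. By continuity the transforms agree at all `n + 1`, so that the finite measures with
densities `e^{-t} (u(t) + c)` and `e^{-t} (v(t) + c)` integrate alike all powers of `e^{-t}`, which
separate points. -/
theorem eq_of_forall_laplace_eq {Λ : Set ℝ} (hΛ_pos : Λ ⊆ Ioi 0) (hΛ_dense : Ioi 0 ⊆ closure Λ)
    (u v : ℝ≥0 →ᵇ ℝ) (h : ∀ lam ∈ Λ, ∫ t in Ioi (0 : ℝ), Real.exp (-lam * t) * u t.toNNReal =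
      ∫ t in Ioi (0 : ℝ), Real.exp (-lam * t) * v t.toNNReal) : u = v := by
  have hall : EqOn (fun lam : ℝ => ∫ t in Ioi (0 : ℝ), Real.exp (-lam * t) * u t.toNNReal)
      (fun lam : ℝ => ∫ t in Ioi (0 : ℝ), Real.exp (-lam * t) * v t.toNNReal) (Ioi 0) :=
    EqOn.of_subset_closure h (continuousOn_laplace u) (continuousOn_laplace v) hΛ_pos hΛ_dense
  let c : ℝ := ‖u‖ + ‖v‖
  let e : ℝ≥0 →ᵇ ℝ := BoundedContinuousFunction.ofNormedAddCommGroup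
    (fun t => Real.exp (-(t : ℝ))) (by fun_prop) 1 (fun t => by
      rw [Real.norm_of_nonneg (Real.exp_pos _).le, Real.exp_le_one_iff]
      exact neg_nonpos.mpr t.2)
  have he : ∀ t, e t = Real.exp (-(t : ℝ)) := fun t => rfl
  let μ : (ℝ≥0 →ᵇ ℝ) → Measure ℝ≥0 := fun w =>
    ((volume.restrict (Ioi (0 : ℝ))).withDensity
      (fun t => ENNReal.ofReal (Real.exp (-t) * (w t.toNNReal + c)))).map Real.toNNReal
  have hint : ∀ w : ℝ≥0 →ᵇ ℝ, IntegrableOn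
      (fun t : ℝ => Real.exp (-t) * w t.toNNReal) (Ioi 0) := by
    intro w
    simpa using integrableOn_exp_mul_boundedContinuous one_pos w
  have hcont : ∀ w : ℝ≥0 →ᵇ ℝ, Continuous fun t : ℝ => w t.toNNReal := fun w =>
    w.continuous.comp continuous_real_toNNReal
  have hfin : ∀ w, IsFiniteMeasure (μ w) := by
    intro w
    have h1 : IntegrableOn (fun t : ℝ => Real.exp (-t) * (w t.toNNReal + c)) (Ioi 0) := by
      exact hint (w + BoundedContinuousFunction.const _ c)
    have := isFiniteMeasure_withDensity_ofReal h1.2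
    exact Measure.isFiniteMeasure_map _ _
  have hμ : ∀ w : ℝ≥0 →ᵇ ℝ, (∀ t, 0 ≤ w t + c) → ∀ F : ℝ≥0 →ᵇ ℝ,
      ∫ t, F t ∂(μ w) =
        ∫ t in Ioi (0 : ℝ), Real.exp (-t) * (w t.toNNReal + c) * F t.toNNReal := by
    intro w hw F
    have hm : Measurable fun t : ℝ => ENNReal.ofReal (Real.exp (-t) * (w t.toNNReal + c)) := by
      have := (hcont w).measurable
      fun_prop
    rw [integral_map continuous_real_toNNReal.measurable.aemeasurable
      F.continuous.aestronglyMeasurable,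
      integral_withDensity_eq_integral_toReal_smul hm (ae_of_all _ fun t => ENNReal.ofReal_lt_top)]
    refine integral_congr_ae (ae_of_all _ fun t => ?_)
    simp only [smul_eq_mul]
    rw [ENNReal.toReal_ofReal (mul_nonneg (Real.exp_pos _).le (hw _))]
  have hu : ∀ t, 0 ≤ u t + c := fun t => by
    have h1 := (abs_le.mp (u.norm_coe_le_norm t)).1
    have h2 := norm_nonneg v
    change 0 ≤ u t + (‖u‖ + ‖v‖)
    linarith
  have hv : ∀ t, 0 ≤ v t + c := fun t => by
    have h1 := (abs_le.mp (v.norm_coe_le_norm t)).1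
    have h2 := norm_nonneg u
    change 0 ≤ v t + (‖u‖ + ‖v‖)
    linarith
  have hsplit : ∀ (w F : ℝ≥0 →ᵇ ℝ),
      ∫ t in Ioi (0 : ℝ), Real.exp (-t) * (w t.toNNReal + c) * F t.toNNReal =
        (∫ t in Ioi (0 : ℝ), Real.exp (-t) * (w * F) t.toNNReal) +
          c * ∫ t in Ioi (0 : ℝ), Real.exp (-t) * F t.toNNReal := by
    intro w F
    rw [← integral_const_mul, ← integral_add (hint _) ((hint F).const_mul c)]
    refine integral_congr_ae (ae_of_all _ fun t => ?_)
    simp only [BoundedContinuousFunction.coe_mul, Pi.mul_apply]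
    ring
  have hmeas : μ u = μ v := by
    have := hfin u
    have := hfin v
    refine ext_of_forall_mem_submonoid_integral_eq (Submonoid.powers e) ?_ ?_
    · intro x y hxy
      have := hxy e (Submonoid.mem_powers e)
      rw [he, he, Real.exp_eq_exp, neg_inj] at this
      exact_mod_cast this
    · rintro _ ⟨n, rfl⟩
      rw [hμ u hu, hμ v hv, hsplit, hsplit]
      congr 1
      have hpow : ∀ w : ℝ≥0 →ᵇ ℝ, ∫ t in Ioi (0 : ℝ), Real.exp (-t) * (w * e ^ n) t.toNNReal =
          ∫ t in Ioi (0 : ℝ), Real.exp (-((n : ℝ) + 1) * t) * w t.toNNReal := by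
        intro w
        refine setIntegral_congr_fun measurableSet_Ioi fun t ht => ?_
        have ht' : ((t.toNNReal : ℝ≥0) : ℝ) = t := Real.coe_toNNReal t (le_of_lt ht)
        simp only [BoundedContinuousFunction.coe_mul, Pi.mul_apply,
          BoundedContinuousFunction.coe_pow, Pi.pow_apply, he, ht']
        rw [← Real.exp_nat_mul, show -((n : ℝ) + 1) * t = -t + n * -t by ring, Real.exp_add]
        ring
      rw [hpow, hpow]
      exact hall (mem_Ioi.mpr (by positivity))
  have hsq : ∫ t in Ioi (0 : ℝ), Real.exp (-t) * ((u - v) * (u - v)) t.toNNReal = 0 := by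
    have h1 : ∫ t, (u - v) t ∂(μ u) = ∫ t, (u - v) t ∂(μ v) := by rw [hmeas]
    rw [hμ u hu, hμ v hv, hsplit, hsplit, add_left_inj] at h1
    have h2 := sub_eq_zero.mpr h1
    rw [← integral_sub (hint _) (hint _)] at h2
    refine Eq.trans (integral_congr_ae (ae_of_all _ fun t => ?_)) h2
    simp only [BoundedContinuousFunction.coe_mul, BoundedContinuousFunction.coe_sub,
      Pi.mul_apply, Pi.sub_apply]
    ring
  have hnn : ∀ t : ℝ, 0 ≤ Real.exp (-t) * ((u - v) * (u - v)) t.toNNReal := fun t =>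
    mul_nonneg (Real.exp_pos _).le (mul_self_nonneg ((u - v) t.toNNReal))
  rw [integral_eq_zero_iff_of_nonneg_ae (ae_of_all _ hnn) (hint ((u - v) * (u - v)))] at hsq
  have hzero : EqOn (fun t : ℝ => Real.exp (-t) * ((u - v) * (u - v)) t.toNNReal) 0 (Ioi 0) :=
    Measure.eqOn_open_of_ae_eq hsq isOpen_Ioi
      (Continuous.continuousOn (by have := hcont ((u - v) * (u - v)); fun_prop)) continuousOn_const
  have hpos : EqOn u v (Ioi 0) := by
    intro t ht
    have := hzero (show (t : ℝ) ∈ Ioi 0 from ht)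
    simpa [Real.exp_ne_zero, sub_eq_zero] using this
  ext t
  refine hpos.of_subset_closure u.continuous.continuousOn v.continuous.continuousOn
    (subset_univ _) ?_ (mem_univ t)
  rw [closure_Ioi' ⟨1, one_pos⟩]
  exact fun t _ => mem_Ici.mpr t.2

end Determining

/-! ### Path space and cylinder functions -/

section PathSpaceLemmas

open Filter Topology

variable {X : Type*} [TopologicalSpace X]

theorem StronglySeparatesPoints.eq_of_forall_eq [T1Space X] {Φ : Set (X →ᵇ ℝ)}
    (hΦ : StronglySeparatesPoints Φ) {x y : X} (h : ∀ φ ∈ Φ, φ x = φ y) : x = y := by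
  by_contra hxy
  obtain ⟨F, hF, ε, hε, hsep⟩ := hΦ x {y}ᶜ (isOpen_compl_singleton.mem_nhds hxy)
  obtain ⟨φ, hφ, hle⟩ := hsep y (by simp)
  rw [h φ (hF hφ), sub_self, abs_zero] at hle
  exact absurd hε (not_lt.mpr hle)

namespace PathSpace

instance instPolishSpace [PolishSpace X] : PolishSpace (PathSpace X) := by
  let := TopologicalSpace.upgradeIsCompletelyMetrizable X
  infer_instance

theorem shift_apply (s t : ℝ≥0) (w : PathSpace X) : shift s w t = w (s + t) := rfl

theorem integral_shiftMeasure (s : ℝ≥0) (P : ProbabilityMeasure (PathSpace X))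
    (f : PathSpace X →ᵇ ℝ) :
    ∫ w, f w ∂(shiftMeasure s P : Measure (PathSpace X)) =
      ∫ w, f (shift s w) ∂(P : Measure (PathSpace X)) :=
  integral_map (continuous_shift s).measurable.aemeasurable f.continuous.aestronglyMeasurable

/-- The function `w ↦ φ(w(t))` on path space. -/
def coordFn (t : ℝ≥0) (φ : X →ᵇ ℝ) : PathSpace X →ᵇ ℝ :=
  φ.compContinuous ⟨fun w => w t, continuous_eval_const t⟩

theorem coordFn_apply (t : ℝ≥0) (φ : X →ᵇ ℝ) (w : PathSpace X) : coordFn t φ w = φ (w t) := rfl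

/-- The cylinder function `w ↦ φ₁(w(t₁)) ⋯ φₙ(w(tₙ))` of a list of pairs `(tᵢ, φᵢ)`. -/
noncomputable def cylinderFn (L : List (ℝ≥0 × (X →ᵇ ℝ))) : PathSpace X →ᵇ ℝ :=
  (L.map fun a => coordFn a.1 a.2).prod

theorem cylinderFn_nil : cylinderFn ([] : List (ℝ≥0 × (X →ᵇ ℝ))) = 1 := rfl

theorem cylinderFn_cons (a : ℝ≥0 × (X →ᵇ ℝ)) (L : List (ℝ≥0 × (X →ᵇ ℝ))) :
    cylinderFn (a :: L) = coordFn a.1 a.2 * cylinderFn L := by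
  simp [cylinderFn]

theorem cylinderFn_append (L L' : List (ℝ≥0 × (X →ᵇ ℝ))) :
    cylinderFn (L ++ L') = cylinderFn L * cylinderFn L' := by
  simp [cylinderFn]

theorem cylinderFn_perm {L L' : List (ℝ≥0 × (X →ᵇ ℝ))} (h : L.Perm L') :
    cylinderFn L = cylinderFn L' :=
  (h.map _).prod_eq

theorem cylinderFn_shift {s : ℝ≥0} {L : List (ℝ≥0 × (X →ᵇ ℝ))} (hL : ∀ a ∈ L, s ≤ a.1)
    (w : PathSpace X) :
    cylinderFn (L.map fun a => (a.1 - s, a.2)) (shift s w) = cylinderFn L w := by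
  induction L with
  | nil => rfl
  | cons a L ih =>
    rw [List.map_cons, cylinderFn_cons, cylinderFn_cons]
    simp only [BoundedContinuousFunction.coe_mul, Pi.mul_apply, coordFn_apply, shift_apply]
    rw [ih fun b hb => hL b (List.mem_cons_of_mem _ hb),
      add_tsub_cancel_of_le (hL a List.mem_cons_self)]

/-- Cylinder functions with times in a dense set and factors in a point-separating family form a
separating multiplicative monoid, so they determine probability measures on path space. -/
theorem ext_of_integral_cylinderFn_eq [PolishSpace X] {Φ : Set (X →ᵇ ℝ)}
    (hΦ : ∀ x y, (∀ φ ∈ Φ, φ x = φ y) → x = y) {T : Set ℝ≥0} (hT : Dense T)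
    {P Q : ProbabilityMeasure (PathSpace X)}
    (h : ∀ L : List (ℝ≥0 × (X →ᵇ ℝ)), (∀ a ∈ L, a ∈ T ×ˢ Φ) →
      ∫ w, cylinderFn L w ∂(P : Measure (PathSpace X)) =
        ∫ w, cylinderFn L w ∂(Q : Measure (PathSpace X))) : P = Q := by
  let S : Submonoid (PathSpace X →ᵇ ℝ) :=
    { carrier := {f | ∃ L : List (ℝ≥0 × (X →ᵇ ℝ)), (∀ a ∈ L, a ∈ T ×ˢ Φ) ∧ cylinderFn L = f}
      one_mem' := ⟨[], by simp, rfl⟩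
      mul_mem' := by
        rintro _ _ ⟨L, hL, rfl⟩ ⟨L', hL', rfl⟩
        refine ⟨L ++ L', fun a ha => ?_, cylinderFn_append L L'⟩
        rcases List.mem_append.mp ha with ha | ha
        exacts [hL a ha, hL' a ha] }
  refine ProbabilityMeasure.toMeasure_injective
    (ext_of_forall_mem_submonoid_integral_eq S (fun w w' hww' => ?_) ?_)
  · have heq : EqOn w w' T := fun t ht => hΦ _ _ fun φ hφ => by
      have := hww' (cylinderFn [(t, φ)]) ⟨[(t, φ)], by simpa using ⟨ht, hφ⟩, rfl⟩
      simpa [cylinderFn, coordFn_apply] using this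
    exact DFunLike.coe_injective (Continuous.ext_on hT w.continuous w'.continuous heq)
  · rintro _ ⟨L, hL, rfl⟩
    exact h L hL

theorem exists_seq_determining [PolishSpace X] {Φ : Set (X →ᵇ ℝ)} (hΦ_countable : Φ.Countable)
    (hΦ : ∀ x y, (∀ φ ∈ Φ, φ x = φ y) → x = y) :
    ∃ F : ℕ → PathSpace X →ᵇ ℝ, ∀ P Q : ProbabilityMeasure (PathSpace X),
      (∀ n, ∫ w, F n w ∂(P : Measure (PathSpace X)) = ∫ w, F n w ∂(Q : Measure (PathSpace X))) →
        P = Q := by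
  obtain ⟨T, hTc, hTd⟩ := TopologicalSpace.exists_countable_dense ℝ≥0
  have hcount : {L : List (ℝ≥0 × (X →ᵇ ℝ)) | ∀ a ∈ L, a ∈ T ×ˢ Φ}.Countable := by
    have := (hTc.prod hΦ_countable).to_subtype
    rw [← Set.range_list_map_coe]
    exact countable_range _
  obtain ⟨e, he⟩ := hcount.exists_eq_range ⟨[], by simp⟩
  refine ⟨fun n => cylinderFn (e n), fun P Q h => ext_of_integral_cylinderFn_eq hΦ hTd ?_⟩
  intro L hL
  have : L ∈ range e := he ▸ hL
  obtain ⟨n, rfl⟩ := this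
  exact h n

/-! ### Discounted functionals -/

theorem norm_exp_mul_le (lam : ℝ) (φ : X →ᵇ ℝ) (t : ℝ) (x : X) :
    ‖Real.exp (-lam * t) * φ x‖ ≤ Real.exp (-lam * t) * ‖φ‖ := by
  rw [norm_mul, Real.norm_of_nonneg (Real.exp_pos _).le]
  exact mul_le_mul_of_nonneg_left (φ.norm_coe_le_norm _) (Real.exp_pos _).le

theorem continuous_path_toNNReal (w : PathSpace X) : Continuous fun t : ℝ => w t.toNNReal :=
  w.continuous.comp continuous_real_toNNReal

/-- The discounted functional `w ↦ ∫_0^∞ e^{-λ t} φ(w(t)) dt` on path space. -/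
noncomputable def discountedFn [PolishSpace X] (lam : ℝ) (hlam : 0 < lam) (φ : X →ᵇ ℝ) :
    PathSpace X →ᵇ ℝ :=
  BoundedContinuousFunction.ofNormedAddCommGroup
    (fun w => ∫ t in Ioi (0 : ℝ), Real.exp (-lam * t) * φ (w t.toNNReal))
    (by
      refine continuous_of_dominated (bound := fun t => Real.exp (-lam * t) * ‖φ‖)
        (fun w => ?_) (fun w => ae_of_all _ fun t => norm_exp_mul_le lam φ t _)
        ((exp_neg_integrableOn_Ioi 0 hlam).mul_const _) (ae_of_all _ fun t => ?_)
      · have := φ.continuous.comp (continuous_path_toNNReal w)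
        exact Continuous.aestronglyMeasurable (by fun_prop)
      · exact continuous_const.mul (coordFn t.toNNReal φ).continuous)
    (∫ t in Ioi (0 : ℝ), Real.exp (-lam * t) * ‖φ‖)
    (fun w => norm_integral_le_of_norm_le ((exp_neg_integrableOn_Ioi 0 hlam).mul_const _)
      (ae_of_all _ fun t => norm_exp_mul_le lam φ t _))

/-- The function `t ↦ ∫ φ(w(t)) P(dw)`. -/
noncomputable def marginalIntegral [PolishSpace X] (φ : X →ᵇ ℝ)
    (P : ProbabilityMeasure (PathSpace X)) : ℝ≥0 →ᵇ ℝ :=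
  BoundedContinuousFunction.ofNormedAddCommGroup
    (fun t => ∫ w, φ (w t) ∂(P : Measure (PathSpace X)))
    (continuous_of_dominated (bound := fun _ => ‖φ‖)
      (fun t => (coordFn t φ).continuous.aestronglyMeasurable)
      (fun t => ae_of_all _ fun w => φ.norm_coe_le_norm _) (integrable_const _)
      (ae_of_all _ fun w => φ.continuous.comp w.continuous))
    ‖φ‖ (fun t => by
      refine (norm_integral_le_of_norm_le (integrable_const ‖φ‖)
        (ae_of_all _ fun w => φ.norm_coe_le_norm _)).trans ?_
      simp)

theorem marginalIntegral_apply [PolishSpace X] (φ : X →ᵇ ℝ)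
    (P : ProbabilityMeasure (PathSpace X)) (t : ℝ≥0) :
    marginalIntegral φ P t = ∫ w, φ (w t) ∂(P : Measure (PathSpace X)) := rfl

theorem integral_discountedFn [PolishSpace X] {lam : ℝ} (hlam : 0 < lam) (φ : X →ᵇ ℝ)
    (P : ProbabilityMeasure (PathSpace X)) :
    ∫ w, discountedFn lam hlam φ w ∂(P : Measure (PathSpace X)) =
      ∫ t in Ioi (0 : ℝ), Real.exp (-lam * t) * marginalIntegral φ P t.toNNReal := by
  have hcont : Continuous fun z : PathSpace X × ℝ =>
      Real.exp (-lam * z.2) * φ (z.1 z.2.toNNReal) := by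
    have h1 : Continuous fun z : PathSpace X × ℝ => z.1 z.2.toNNReal :=
      continuous_fst.eval (continuous_real_toNNReal.comp continuous_snd)
    have := φ.continuous.comp h1
    fun_prop
  have hint : Integrable (Function.uncurry fun (w : PathSpace X) (t : ℝ) =>
      Real.exp (-lam * t) * φ (w t.toNNReal))
      ((P : Measure (PathSpace X)).prod (volume.restrict (Ioi (0 : ℝ)))) := by
    refine Integrable.mono' (g := fun z => 1 * (Real.exp (-lam * z.2) * ‖φ‖)) ?_
      hcont.aestronglyMeasurable (ae_of_all _ fun z => ?_)
    · exact (integrable_const (1 : ℝ)).mul_prod ((exp_neg_integrableOn_Ioi 0 hlam).mul_const ‖φ‖)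
    · rw [one_mul]
      exact norm_exp_mul_le lam φ z.2 _
  change ∫ w, (∫ t in Ioi (0 : ℝ), Real.exp (-lam * t) * φ (w t.toNNReal))
    ∂(P : Measure (PathSpace X)) = _
  rw [integral_integral_swap hint]
  simp only [integral_const_mul, marginalIntegral_apply]

theorem marginalIntegral_shiftMeasure [PolishSpace X] (φ : X →ᵇ ℝ) (s t : ℝ≥0)
    (P : ProbabilityMeasure (PathSpace X)) :
    marginalIntegral φ (shiftMeasure s P) t = marginalIntegral φ P (s + t) :=
  integral_shiftMeasure s P (coordFn t φ)

/-- The discounted functional splits at time `s` into its truncation and the discounted functional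
of the shifted measure. -/
theorem integral_discountedFn_eq_add [PolishSpace X] {lam : ℝ} (hlam : 0 < lam) (φ : X →ᵇ ℝ)
    (s : ℝ≥0) (P : ProbabilityMeasure (PathSpace X)) :
    ∫ w, discountedFn lam hlam φ w ∂(P : Measure (PathSpace X)) =
      zetaTrunc lam φ s P + Real.exp (-lam * s) *
        ∫ w, discountedFn lam hlam φ w ∂(shiftMeasure s P : Measure (PathSpace X)) := by
  have hint := integrableOn_exp_mul_boundedContinuous hlam (marginalIntegral φ P)
  have hzeta : zetaTrunc lam φ s P =
      ∫ t in (0 : ℝ)..(s : ℝ), Real.exp (-lam * t) * marginalIntegral φ P t.toNNReal := rfl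
  rw [integral_discountedFn, integral_discountedFn, hzeta,
    ← intervalIntegral.integral_interval_add_Ioi hint
      (hint.mono_set (Ioi_subset_Ioi s.coe_nonneg))]
  congr 1
  have hmp : MeasurePreserving (fun t : ℝ => t + s) volume volume :=
    measurePreserving_add_right volume (s : ℝ)
  have hpre : (fun t : ℝ => t + s) ⁻¹' Ioi (s : ℝ) = Ioi 0 := by
    ext t
    simp
  rw [← hmp.setIntegral_preimage_emb (measurableEmbedding_addRight (s : ℝ)), hpre,
    ← integral_const_mul]
  refine setIntegral_congr_fun measurableSet_Ioi fun t ht => ?_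
  have ht' : (0 : ℝ) ≤ t := le_of_lt ht
  have h1 : (t + s).toNNReal = s + t.toNNReal := by
    rw [Real.toNNReal_add ht' s.coe_nonneg, Real.toNNReal_coe, add_comm]
  simp only [marginalIntegral_shiftMeasure, h1]
  rw [← mul_assoc, ← Real.exp_add]
  congr 2
  ring

/-- Probability measures on path space with the same discounted functionals have the same
one-dimensional marginals. -/
theorem map_eval_eq_of_integral_discountedFn_eq [PolishSpace X] [MeasurableSpace X] [BorelSpace X]
    {Φ : Set (X →ᵇ ℝ)} (hΦ : ∀ x y, (∀ φ ∈ Φ, φ x = φ y) → x = y)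
    (hΦ_mul : ∀ φ ∈ Φ, ∀ ψ ∈ Φ, φ * ψ ∈ Φ)
    {Λ : Set ℝ} (hΛ_pos : Λ ⊆ Ioi 0) (hΛ_dense : Ioi 0 ⊆ closure Λ)
    {P Q : ProbabilityMeasure (PathSpace X)}
    (h : ∀ lam (hlam : lam ∈ Λ), ∀ φ ∈ Φ,
      ∫ w, discountedFn lam (hΛ_pos hlam) φ w ∂(P : Measure (PathSpace X)) =
        ∫ w, discountedFn lam (hΛ_pos hlam) φ w ∂(Q : Measure (PathSpace X))) (t : ℝ≥0) :
    (P : Measure (PathSpace X)).map (fun w => w t) =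
      (Q : Measure (PathSpace X)).map (fun w => w t) := by
  have hev : Measurable fun w : PathSpace X => w t :=
    (continuous_eval_const t).measurable
  have hmarg : ∀ φ ∈ Φ, marginalIntegral φ P = marginalIntegral φ Q := by
    intro φ hφ
    refine eq_of_forall_laplace_eq hΛ_pos hΛ_dense _ _ fun lam hlam => ?_
    rw [← integral_discountedFn (hΛ_pos hlam), ← integral_discountedFn (hΛ_pos hlam)]
    exact h lam hlam φ hφ
  let S : Submonoid (X →ᵇ ℝ) :=
    { carrier := insert 1 Φ
      one_mem' := mem_insert _ _
      mul_mem' := by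
        rintro φ ψ (rfl | hφ) (rfl | hψ)
        · simp
        · simpa using Or.inr hψ
        · simpa using Or.inr hφ
        · exact Or.inr (hΦ_mul φ hφ ψ hψ) }
  have := Measure.isProbabilityMeasure_map (μ := (P : Measure (PathSpace X))) hev.aemeasurable
  have := Measure.isProbabilityMeasure_map (μ := (Q : Measure (PathSpace X))) hev.aemeasurable
  refine ext_of_forall_mem_submonoid_integral_eq S
    (fun x y hxy => hΦ x y fun φ hφ => hxy φ (mem_insert_of_mem _ hφ)) ?_
  rintro φ (rfl | hφ)
  · simp
  · rw [integral_map hev.aemeasurable φ.continuous.aestronglyMeasurable,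
      integral_map hev.aemeasurable φ.continuous.aestronglyMeasurable]
    exact DFunLike.congr_fun (hmarg φ hφ) t

end PathSpace

end PathSpaceLemmas

/-! ### Support functions and mixtures -/

section Support

open Filter Topology

variable {X : Type*} [TopologicalSpace X]

theorem abs_integral_le_norm (P : ProbabilityMeasure (PathSpace X)) (f : PathSpace X →ᵇ ℝ) :
    |∫ w, f w ∂(P : Measure (PathSpace X))| ≤ ‖f‖ :=
  f.norm_integral_le_norm (P : Measure (PathSpace X))

theorem supportFn_eq_of_forall_eq {C : X → Set (ProbabilityMeasure (PathSpace X))} {x : X}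
    {f : PathSpace X →ᵇ ℝ} {P : ProbabilityMeasure (PathSpace X)} (hP : P ∈ C x)
    (h : ∀ Q ∈ C x, ∫ w, f w ∂(Q : Measure (PathSpace X)) =
      ∫ w, f w ∂(P : Measure (PathSpace X))) :
    supportFn C x f = ∫ w, f w ∂(P : Measure (PathSpace X)) := by
  have himg : (fun Q : ProbabilityMeasure (PathSpace X) =>
      ∫ w, f w ∂(Q : Measure (PathSpace X))) '' C x =
        {∫ w, f w ∂(P : Measure (PathSpace X))} := by
    ext a
    constructor
    · rintro ⟨Q, hQ, rfl⟩
      exact h Q hQ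
    · rintro rfl
      exact ⟨P, hP, rfl⟩
  rw [supportFn, himg, csSup_singleton]

variable [MeasurableSpace X]

namespace IsMeasurableCompactValued

variable {C : X → Set (ProbabilityMeasure (PathSpace X))}

theorem le_supportFn (hC : IsMeasurableCompactValued C) {x : X}
    {P : ProbabilityMeasure (PathSpace X)} (hP : P ∈ C x) (f : PathSpace X →ᵇ ℝ) :
    ∫ w, f w ∂(P : Measure (PathSpace X)) ≤ supportFn C x f :=
  le_csSup ((hC.isCompact x).image
    (ProbabilityMeasure.continuous_integral_boundedContinuousFunction f)).bddAbove ⟨P, hP, rfl⟩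

theorem exists_integral_eq_supportFn (hC : IsMeasurableCompactValued C) (x : X)
    (f : PathSpace X →ᵇ ℝ) :
    ∃ P ∈ C x, ∫ w, f w ∂(P : Measure (PathSpace X)) = supportFn C x f := by
  obtain ⟨P, hP, h⟩ := (hC.isCompact x).exists_sSup_image_eq (hC.nonempty x)
    (ProbabilityMeasure.continuous_integral_boundedContinuousFunction f).continuousOn
  exact ⟨P, hP, h.symm⟩

theorem supportFn_le (hC : IsMeasurableCompactValued C) {x : X} {f : PathSpace X →ᵇ ℝ} {a : ℝ}
    (h : ∀ P ∈ C x, ∫ w, f w ∂(P : Measure (PathSpace X)) ≤ a) : supportFn C x f ≤ a := by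
  obtain ⟨P, hP, hPeq⟩ := hC.exists_integral_eq_supportFn x f
  exact hPeq ▸ h P hP

theorem abs_supportFn_le (hC : IsMeasurableCompactValued C) (x : X) (f : PathSpace X →ᵇ ℝ) :
    |supportFn C x f| ≤ ‖f‖ := by
  obtain ⟨P, -, hPeq⟩ := hC.exists_integral_eq_supportFn x f
  exact hPeq ▸ abs_integral_le_norm P f

theorem measurable_supportFn (hC : IsMeasurableCompactValued C) (f : PathSpace X →ᵇ ℝ) :
    Measurable fun x => supportFn C x f := by
  have hf := ProbabilityMeasure.continuous_integral_boundedContinuousFunction f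
  refine measurable_of_Ici fun a => ?_
  convert hC.measurableSet _ (isClosed_le (continuous_const (y := a)) hf) using 1
  ext x
  constructor
  · intro h
    obtain ⟨P, hP, hPeq⟩ := hC.exists_integral_eq_supportFn x f
    exact ⟨P, hP, show a ≤ _ by rw [hPeq]; exact h⟩
  · rintro ⟨P, hP, h⟩
    exact le_trans h (hC.le_supportFn hP f)

variable [BorelSpace X]

theorem measurable_supportFn_eval (hC : IsMeasurableCompactValued C) (s : ℝ≥0)
    (f : PathSpace X →ᵇ ℝ) : Measurable fun w : PathSpace X => supportFn C (w s) f :=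
  (hC.measurable_supportFn f).comp (continuous_eval_const s).measurable

theorem integrable_supportFn_eval (hC : IsMeasurableCompactValued C) (s : ℝ≥0)
    (f : PathSpace X →ᵇ ℝ) (P : ProbabilityMeasure (PathSpace X)) :
    Integrable (fun w : PathSpace X => supportFn C (w s) f) (P : Measure (PathSpace X)) :=
  Integrable.of_bound (hC.measurable_supportFn_eval s f).aestronglyMeasurable ‖f‖
    (ae_of_all _ fun w => hC.abs_supportFn_le (w s) f)

end IsMeasurableCompactValued

/-- A map into probability measures that is Borel for weak convergence is measurable for the
`σ`-algebra generated by the evaluations at measurable sets. -/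
theorem measurable_toMeasure_of_measurable_borel [PolishSpace X]
    {p : X → ProbabilityMeasure (PathSpace X)}
    (hp : Measurable[inferInstance, borel (ProbabilityMeasure (PathSpace X))] p) :
    Measurable fun x => (p x : Measure (PathSpace X)) := by
  have hf : ∀ f : PathSpace X →ᵇ ℝ≥0,
      Measurable fun x => ∫⁻ w, f w ∂(p x : Measure (PathSpace X)) := fun f =>
    (ProbabilityMeasure.continuous_lintegral_boundedContinuousFunction f).borel_measurable.comp hp
  refine Measurable.measure_of_isPiSystem_of_isProbabilityMeasure
    (borel_eq_generateFrom_isClosed (α := PathSpace X)) isPiSystem_isClosed fun F hF => ?_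
  have hF : IsClosed F := hF
  refine measurable_of_tendsto_metrizable (fun n => hf (hF.apprSeq n)) ?_
  rw [tendsto_pi_nhds]
  exact fun x => HasOuterApproxClosed.tendsto_lintegral_apprSeq hF _

variable [BorelSpace X]

/-- The mixture `∫ p_{w(s)} P(dw)` of a measurable family of probability measures. -/
noncomputable def mixture (p : X → ProbabilityMeasure (PathSpace X))
    (hp : Measurable fun x => (p x : Measure (PathSpace X)))
    (P : ProbabilityMeasure (PathSpace X)) (s : ℝ≥0) : ProbabilityMeasure (PathSpace X) :=
  ⟨(P : Measure (PathSpace X)).bind fun w => (p (w s) : Measure (PathSpace X)),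
    isProbabilityMeasure_bind
      (hp.comp (continuous_eval_const s).measurable).aemeasurable
      (ae_of_all _ fun _ => inferInstance)⟩

theorem mixture_apply {p : X → ProbabilityMeasure (PathSpace X)}
    (hp : Measurable fun x => (p x : Measure (PathSpace X)))
    (P : ProbabilityMeasure (PathSpace X)) (s : ℝ≥0) {A : Set (PathSpace X)}
    (hA : MeasurableSet A) : (mixture p hp P s : Measure (PathSpace X)) A =
      ∫⁻ w, (p (w s) : Measure (PathSpace X)) A ∂(P : Measure (PathSpace X)) :=
  Measure.bind_apply hA (hp.comp (continuous_eval_const s).measurable).aemeasurable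

theorem integral_mixture {p : X → ProbabilityMeasure (PathSpace X)}
    (hp : Measurable fun x => (p x : Measure (PathSpace X)))
    (P : ProbabilityMeasure (PathSpace X)) (s : ℝ≥0) (f : PathSpace X →ᵇ ℝ) :
    ∫ v, f v ∂(mixture p hp P s : Measure (PathSpace X)) =
      ∫ w, ∫ v, f v ∂(p (w s) : Measure (PathSpace X)) ∂(P : Measure (PathSpace X)) := by
  let η : ProbabilityTheory.Kernel (PathSpace X) (PathSpace X) :=
    ⟨fun w => (p (w s) : Measure (PathSpace X)), hp.comp (continuous_eval_const s).measurable⟩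
  exact ProbabilityTheory.Kernel.integral_comp (η := η)
    (κ := ProbabilityTheory.Kernel.const Unit (P : Measure (PathSpace X))) (a := ())
    (f.integrable (mixture p hp P s : Measure (PathSpace X)))

theorem mixture_mem_krylovK {C : X → Set (ProbabilityMeasure (PathSpace X))}
    (hC : IsMeasurableCompactValued C) {p : X → ProbabilityMeasure (PathSpace X)}
    (hp : Measurable fun x => (p x : Measure (PathSpace X))) (hpC : ∀ x, p x ∈ C x)
    (P : ProbabilityMeasure (PathSpace X)) (s : ℝ≥0) : mixture p hp P s ∈ krylovK C P s := by
  intro f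
  rw [integral_mixture]
  let η : ProbabilityTheory.Kernel (PathSpace X) (PathSpace X) :=
    ⟨fun w => (p (w s) : Measure (PathSpace X)), hp.comp (continuous_eval_const s).measurable⟩
  have hmeas : StronglyMeasurable fun w : PathSpace X => ∫ v, f v ∂(η w) :=
    f.continuous.stronglyMeasurable.integral_kernel
  have hint : Integrable (fun w : PathSpace X => ∫ v, f v ∂(p (w s) : Measure (PathSpace X)))
      (P : Measure (PathSpace X)) :=
    Integrable.of_bound hmeas.aestronglyMeasurable ‖f‖
      (ae_of_all _ fun w => abs_integral_le_norm (p (w s)) f)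
  exact integral_mono hint (hC.integrable_supportFn_eval s f P)
    fun w => hC.le_supportFn (hpC (w s)) f

end Support

/-! ### Maximization of discounted functionals preserves the Krylov property -/

section Krylov

open Filter Topology

variable {X : Type*} [TopologicalSpace X] [MeasurableSpace X]

/-- The part of the Krylov property that survives maximization: the pairs in `I` index the
functionals whose truncations may be kept from decreasing when a measure of `K(P, s, 𝒞)` is
prescribed as the law after time `s`. -/
structure IsWeakKrylov (I : Set (ℝ × (X →ᵇ ℝ))) (C : X → Set (ProbabilityMeasure (PathSpace X))) :
    Prop extends IsMeasurableCompactValued C where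
  shift_mem : ∀ x, ∀ s : ℝ≥0, 0 < s → ∀ P ∈ C x, PathSpace.shiftMeasure s P ∈ krylovK C P s
  exists_shift_eq : ∀ x, ∀ s : ℝ≥0, 0 < s → ∀ P ∈ C x, ∀ Q ∈ krylovK C P s,
    ∃ R ∈ C x, PathSpace.shiftMeasure s R = Q ∧
      ∀ i ∈ I, zetaTrunc i.1 i.2 s P ≤ zetaTrunc i.1 i.2 s R

variable {C : X → Set (ProbabilityMeasure (PathSpace X))}

/-- The set-valued map of maximizers of `P ↦ ∫ z dP` over the values of `C`. -/
noncomputable def maximizers (C : X → Set (ProbabilityMeasure (PathSpace X)))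
    (z : PathSpace X →ᵇ ℝ) : X → Set (ProbabilityMeasure (PathSpace X)) :=
  argmaxSet C fun P => ∫ w, z w ∂(P : Measure (PathSpace X))

namespace IsMeasurableCompactValued

theorem maximizers (hC : IsMeasurableCompactValued C) (z : PathSpace X →ᵇ ℝ) :
    IsMeasurableCompactValued (maximizers C z) :=
  hC.argmaxSet (ProbabilityMeasure.continuous_integral_boundedContinuousFunction z)

theorem mem_maximizers_iff (hC : IsMeasurableCompactValued C) {x : X} {z : PathSpace X →ᵇ ℝ}
    {P : ProbabilityMeasure (PathSpace X)} (hP : P ∈ C x) :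
    P ∈ _root_.maximizers C z x ↔
      ∫ w, z w ∂(P : Measure (PathSpace X)) = supportFn C x z := by
  constructor
  · rintro ⟨-, hmax⟩
    exact le_antisymm (hC.le_supportFn hP z) (hC.supportFn_le fun Q hQ => hmax hQ)
  · intro h
    exact ⟨hP, fun Q hQ => (hC.le_supportFn hQ z).trans h.ge⟩

theorem supportFn_mono {D : X → Set (ProbabilityMeasure (PathSpace X))}
    (hC : IsMeasurableCompactValued C) (hD : IsMeasurableCompactValued D) {x : X}
    (h : D x ⊆ C x) (f : PathSpace X →ᵇ ℝ) : supportFn D x f ≤ supportFn C x f :=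
  hD.supportFn_le fun _ hP => hC.le_supportFn (h hP) f

theorem supportFn_neg_maximizers (hC : IsMeasurableCompactValued C) (x : X)
    (z : PathSpace X →ᵇ ℝ) :
    supportFn (_root_.maximizers C z) x (-z) = -supportFn C x z := by
  obtain ⟨P, hP⟩ := (hC.maximizers z).nonempty x
  have hval : ∀ Q ∈ _root_.maximizers C z x,
      ∫ w, (-z) w ∂(Q : Measure (PathSpace X)) = -supportFn C x z := by
    intro Q hQ
    rw [← (hC.mem_maximizers_iff hQ.1).mp hQ, ← integral_neg]
    rfl
  rw [supportFn_eq_of_forall_eq hP fun Q hQ => (hval Q hQ).trans (hval P hP).symm, hval P hP]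

theorem integral_supportFn_le_of_mem_krylovK_maximizers (hC : IsMeasurableCompactValued C)
    {z : PathSpace X →ᵇ ℝ} {P Q : ProbabilityMeasure (PathSpace X)} {s : ℝ≥0}
    (hQ : Q ∈ krylovK (_root_.maximizers C z) P s) :
    ∫ w, supportFn C (w s) z ∂(P : Measure (PathSpace X)) ≤
      ∫ w, z w ∂(Q : Measure (PathSpace X)) := by
  have h := hQ (-z)
  simp only [hC.supportFn_neg_maximizers, BoundedContinuousFunction.coe_neg, Pi.neg_apply,
    integral_neg, neg_le_neg_iff] at h
  exact h

variable [BorelSpace X]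

theorem krylovK_mono {D : X → Set (ProbabilityMeasure (PathSpace X))}
    (hC : IsMeasurableCompactValued C) (hD : IsMeasurableCompactValued D)
    (h : ∀ x, D x ⊆ C x) (P : ProbabilityMeasure (PathSpace X)) (s : ℝ≥0) :
    krylovK D P s ⊆ krylovK C P s := fun _ hQ f =>
  (hQ f).trans (integral_mono (hD.integrable_supportFn_eval s f P)
    (hC.integrable_supportFn_eval s f P) fun w => hC.supportFn_mono hD (h (w s)) f)

/-- A measure in `K(P, s, 𝒞)` lies in `K(P, s, 𝒞')` for the map `𝒞'` of maximizers of `z` as soon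
as it gives `z` the largest possible integral. The reason is that `𝒞'` is reached by penalization:
`h[f + n z] - n h[z]` converges to the support function of `𝒞'`. -/
theorem mem_krylovK_maximizers (hC : IsMeasurableCompactValued C) {z : PathSpace X →ᵇ ℝ}
    {P Q : ProbabilityMeasure (PathSpace X)} {s : ℝ≥0} (hQ : Q ∈ krylovK C P s)
    (hz : ∫ w, supportFn C (w s) z ∂(P : Measure (PathSpace X)) ≤
      ∫ w, z w ∂(Q : Measure (PathSpace X))) : Q ∈ krylovK (_root_.maximizers C z) P s := by
  intro f
  let F : ℕ → PathSpace X → ℝ := fun n w =>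
    supportFn C (w s) (f + (n : ℝ) • z) - n * supportFn C (w s) z
  have hint : ∀ (n : ℕ) (R : ProbabilityMeasure (PathSpace X)),
      ∫ v, (f + (n : ℝ) • z) v ∂(R : Measure (PathSpace X)) =
        ∫ v, f v ∂(R : Measure (PathSpace X)) + n * ∫ v, z v ∂(R : Measure (PathSpace X)) := by
    intro n R
    rw [← integral_const_mul, ← integral_add (f.integrable _) ((z.integrable _).const_mul _)]
    rfl
  have hle : ∀ n, ∫ v, f v ∂(Q : Measure (PathSpace X)) ≤
      ∫ w, F n w ∂(P : Measure (PathSpace X)) := by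
    intro n
    have h1 := hQ (f + (n : ℝ) • z)
    rw [hint] at h1
    rw [integral_sub (hC.integrable_supportFn_eval s _ P)
      ((hC.integrable_supportFn_eval s z P).const_mul _), integral_const_mul]
    have h2 := mul_le_mul_of_nonneg_left hz (Nat.cast_nonneg (α := ℝ) n)
    linarith
  have hlim : Tendsto (fun n => ∫ w, F n w ∂(P : Measure (PathSpace X))) atTop
      (𝓝 (∫ w, supportFn (_root_.maximizers C z) (w s) f ∂(P : Measure (PathSpace X)))) := by
    refine tendsto_integral_of_dominated_convergence (fun _ => ‖f‖) (fun n => ?_)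
      (integrable_const _) (fun n => ae_of_all _ fun w => ?_) (ae_of_all _ fun w => ?_)
    · exact ((hC.measurable_supportFn_eval s _).sub
        ((hC.measurable_supportFn_eval s z).const_mul _)).aestronglyMeasurable
    · have hn : (0 : ℝ) ≤ n := n.cast_nonneg
      refine abs_le.mpr ⟨?_, ?_⟩
      · obtain ⟨R, hR, hReq⟩ := hC.exists_integral_eq_supportFn (w s) z
        have h1 := hC.le_supportFn hR (f + (n : ℝ) • z)
        rw [hint, hReq] at h1
        have h2 := (abs_le.mp (abs_integral_le_norm R f)).1
        linarith
      · obtain ⟨R, hR, hReq⟩ := hC.exists_integral_eq_supportFn (w s) (f + (n : ℝ) • z)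
        rw [hint] at hReq
        have h1 := mul_le_mul_of_nonneg_left (hC.le_supportFn hR z) hn
        have h2 := (abs_le.mp (abs_integral_le_norm R f)).2
        linarith
    · have := tendsto_sSup_image_penalized (hC.isCompact (w s)) (hC.nonempty (w s))
        (ProbabilityMeasure.continuous_integral_boundedContinuousFunction f)
        (ProbabilityMeasure.continuous_integral_boundedContinuousFunction z)
      simp only [← hint] at this
      exact this
  exact ge_of_tendsto' hlim hle

end IsMeasurableCompactValued

/-- If the integral of `f` is constant on each value of `C`, membership in `K(P, s, 𝒞)` for `f`
and `-f` is an equality. -/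
theorem integral_eq_of_mem_krylovK (hC : IsMeasurableCompactValued C)
    {P Q : ProbabilityMeasure (PathSpace X)} {s : ℝ≥0} (hQ : Q ∈ krylovK C P s)
    {f : PathSpace X →ᵇ ℝ}
    (hf : ∀ y, ∀ R ∈ C y, ∀ R' ∈ C y,
      ∫ w, f w ∂(R : Measure (PathSpace X)) = ∫ w, f w ∂(R' : Measure (PathSpace X))) :
    ∫ w, f w ∂(Q : Measure (PathSpace X)) =
      ∫ w, supportFn C (w s) f ∂(P : Measure (PathSpace X)) := by
  have hneg : ∀ y, supportFn C y (-f) = -supportFn C y f := by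
    intro y
    obtain ⟨R, hR⟩ := hC.nonempty y
    rw [supportFn_eq_of_forall_eq hR fun R' hR' => hf y R' hR' R hR,
      supportFn_eq_of_forall_eq hR fun R' hR' => ?_, ← integral_neg]
    · rfl
    · simp only [BoundedContinuousFunction.coe_neg, Pi.neg_apply, integral_neg, hf y R' hR' R hR]
  have h := hQ (-f)
  simp only [hneg, BoundedContinuousFunction.coe_neg, Pi.neg_apply, integral_neg,
    neg_le_neg_iff] at h
  exact le_antisymm (hQ f) h

variable [PolishSpace X] [BorelSpace X]

/-- Maximizing a discounted functional preserves the weak Krylov property. If `P` is a maximizer,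
mixing a measurable selection of the maximizers along `P` and pulling the mixture back to a
measure in `𝒞(x)` cannot improve on `P`; hence `θ_s P` already gives the functional its largest
possible integral. -/
theorem IsWeakKrylov.maximizers {I : Set (ℝ × (X →ᵇ ℝ))} (hC : IsWeakKrylov I C)
    {F : ℕ → PathSpace X →ᵇ ℝ}
    (hF : ∀ P Q : ProbabilityMeasure (PathSpace X),
      (∀ n, ∫ w, F n w ∂(P : Measure (PathSpace X)) =
        ∫ w, F n w ∂(Q : Measure (PathSpace X))) → P = Q)
    {lam : ℝ} (hlam : 0 < lam) {φ : X →ᵇ ℝ} (hI : (lam, φ) ∈ I) :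
    IsWeakKrylov I (maximizers C (PathSpace.discountedFn lam hlam φ)) := by
  have hM := hC.toIsMeasurableCompactValued
  set z := PathSpace.discountedFn lam hlam φ with hz
  have hM' := hM.maximizers z
  refine ⟨hM', fun x s hs P hP => ?_, fun x s hs P hP Q hQ => ?_⟩
  · obtain ⟨p, hp, hpC⟩ := hM'.exists_measurable_selection
      (fun n => ProbabilityMeasure.continuous_integral_boundedContinuousFunction (F n)) hF
    have hp' := measurable_toMeasure_of_measurable_borel hp
    obtain ⟨R, hR, hReq, hRle⟩ := hC.exists_shift_eq x s hs P hP.1 (mixture p hp' P s)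
      (mixture_mem_krylovK hM hp' (fun y => (hpC y).1) P s)
    refine hM.mem_krylovK_maximizers (hC.shift_mem x s hs P hP.1) ?_
    have hmix : ∫ w, z w ∂(mixture p hp' P s : Measure (PathSpace X)) =
        ∫ w, supportFn C (w s) z ∂(P : Measure (PathSpace X)) := by
      rw [integral_mixture]
      exact integral_congr_ae (ae_of_all _ fun w => (hM.mem_maximizers_iff (hpC (w s)).1).mp
        (hpC (w s)))
    have hmax : ∫ w, z w ∂(R : Measure (PathSpace X)) ≤ ∫ w, z w ∂(P : Measure (PathSpace X)) :=
      hP.2 hR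
    rw [hz, PathSpace.integral_discountedFn_eq_add hlam φ s R,
      PathSpace.integral_discountedFn_eq_add hlam φ s P, hReq, ← hz, hmix] at hmax
    have hle := hRle _ hI
    exact le_of_mul_le_mul_left (by linarith) (Real.exp_pos (-lam * s))
  · obtain ⟨R, hR, hReq, hRle⟩ := hC.exists_shift_eq x s hs P hP.1 Q
      (hM.krylovK_mono hM' (fun y => argmaxSet_subset _ _ y) P s hQ)
    refine ⟨R, ⟨hR, fun S hS => ?_⟩, hReq, hRle⟩
    have h1 : ∫ w, z w ∂(PathSpace.shiftMeasure s P : Measure (PathSpace X)) ≤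
        ∫ w, z w ∂(Q : Measure (PathSpace X)) :=
      (hC.shift_mem x s hs P hP.1 z).trans
        (hM.integral_supportFn_le_of_mem_krylovK_maximizers hQ)
    have h2 : ∫ w, z w ∂(P : Measure (PathSpace X)) ≤ ∫ w, z w ∂(R : Measure (PathSpace X)) := by
      rw [hz, PathSpace.integral_discountedFn_eq_add hlam φ s R,
        PathSpace.integral_discountedFn_eq_add hlam φ s P, hReq]
      exact add_le_add (hRle _ hI) (mul_le_mul_of_nonneg_left h1 (Real.exp_pos _).le)
    exact le_trans (hP.2 hS) h2

/-! ### Uniqueness in the limit and the Markov property -/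

/-- The shift condition passes to decreasing intersections, because the support functions
converge boundedly. -/
theorem shift_mem_krylovK_iInter {C : ℕ → X → Set (ProbabilityMeasure (PathSpace X))}
    (hC : ∀ n, IsMeasurableCompactValued (C n)) (hanti : ∀ n x, C (n + 1) x ⊆ C n x)
    {P Q : ProbabilityMeasure (PathSpace X)} {s : ℝ≥0} (hQ : ∀ n, Q ∈ krylovK (C n) P s) :
    Q ∈ krylovK (fun x => ⋂ n, C n x) P s := by
  intro f
  refine ge_of_tendsto' (tendsto_integral_of_dominated_convergence (fun _ => ‖f‖) (fun n => ?_)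
    (integrable_const _) (fun n => ae_of_all _ fun w => (hC n).abs_supportFn_le (w s) f)
    (ae_of_all _ fun w => ?_)) fun n => hQ n f
  · exact ((hC n).measurable_supportFn_eval s f).aestronglyMeasurable
  · exact tendsto_sSup_image_iInter (fun n => (hC n).isCompact (w s))
      (fun n => (hC n).nonempty (w s)) (fun n => hanti n (w s))
      (ProbabilityMeasure.continuous_integral_boundedContinuousFunction f)

/-- If the members of each value of `C` have the same one-dimensional marginals, they integrate
alike all cylinder functions. The induction is on the number of times: shifting by the earliest
time `s` turns a cylinder function into `φ(w(0))` times a shorter one, whose integral depends on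
the starting point only, so the integral is determined by the marginal at time `s`. -/
theorem integral_cylinderFn_eq (hC : IsMeasurableCompactValued C)
    (hsupp : ∀ x, ∀ P ∈ C x, (P : Measure (PathSpace X)) {w | w 0 = x} = 1)
    (hshift : ∀ x, ∀ s : ℝ≥0, 0 < s → ∀ P ∈ C x, PathSpace.shiftMeasure s P ∈ krylovK C P s)
    (hmarg : ∀ x, ∀ P ∈ C x, ∀ Q ∈ C x, ∀ t : ℝ≥0,
      (P : Measure (PathSpace X)).map (fun w => w t) =
        (Q : Measure (PathSpace X)).map (fun w => w t))
    (n : ℕ) : ∀ L : List (ℝ≥0 × (X →ᵇ ℝ)), L.length = n → ∀ x, ∀ P ∈ C x, ∀ Q ∈ C x,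
      ∫ w, PathSpace.cylinderFn L w ∂(P : Measure (PathSpace X)) =
        ∫ w, PathSpace.cylinderFn L w ∂(Q : Measure (PathSpace X)) := by
  induction n with
  | zero =>
    intro L hL x P _ Q _
    rw [List.length_eq_zero_iff.mp hL, PathSpace.cylinderFn_nil]
    simp
  | succ n ih =>
    intro L hL x P hP Q hQ
    -- split off an entry of `L` with the earliest time
    obtain ⟨a, ha, hmin⟩ : ∃ a ∈ L, ∀ b ∈ L, a.1 ≤ b.1 := by
      classical
      have hne : L.toFinset.Nonempty := by
        rw [List.toFinset_nonempty_iff]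
        rintro rfl
        simp at hL
      obtain ⟨a, ha, hmin⟩ := L.toFinset.exists_min_image Prod.fst hne
      exact ⟨a, List.mem_toFinset.mp ha, fun b hb => hmin b (List.mem_toFinset.mpr hb)⟩
    obtain ⟨s, φ⟩ := a
    obtain ⟨L', hperm⟩ : ∃ L', L.Perm ((s, φ) :: L') := by
      classical
      exact ⟨_, List.perm_cons_erase ha⟩
    have hmin' : ∀ b ∈ L', s ≤ b.1 := fun b hb =>
      hmin b (hperm.mem_iff.mpr (List.mem_cons_of_mem _ hb))
    have hlen : L'.length = n := by
      have := hperm.length_eq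
      rw [hL, List.length_cons] at this
      omega
    let G := PathSpace.cylinderFn (L'.map fun b => (b.1 - s, b.2))
    let f : PathSpace X →ᵇ ℝ := PathSpace.coordFn 0 φ * G
    have hG : ∀ y, ∀ R ∈ C y, ∀ R' ∈ C y, ∫ w, G w ∂(R : Measure (PathSpace X)) =
        ∫ w, G w ∂(R' : Measure (PathSpace X)) :=
      ih _ (by rw [List.length_map, hlen])
    have hfG : ∀ y, ∀ R ∈ C y, ∫ w, f w ∂(R : Measure (PathSpace X)) =
        φ y * ∫ w, G w ∂(R : Measure (PathSpace X)) := by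
      intro y R hR
      have hcl : IsClosed {w : PathSpace X | w 0 = y} :=
        isClosed_eq (continuous_eval_const 0) continuous_const
      have hae : ∀ᵐ w ∂(R : Measure (PathSpace X)), w 0 = y :=
        (prob_compl_eq_zero_iff hcl.measurableSet).mpr (hsupp y R hR)
      rw [← integral_const_mul]
      refine integral_congr_ae (hae.mono fun w hw => ?_)
      change φ (w 0) * G w = φ y * G w
      rw [hw]
    have hf : ∀ y, ∀ R ∈ C y, ∀ R' ∈ C y, ∫ w, f w ∂(R : Measure (PathSpace X)) =
        ∫ w, f w ∂(R' : Measure (PathSpace X)) := by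
      intro y R hR R' hR'
      rw [hfG y R hR, hfG y R' hR', hG y R hR R' hR']
    have hLf : ∀ R : ProbabilityMeasure (PathSpace X),
        ∫ w, PathSpace.cylinderFn L w ∂(R : Measure (PathSpace X)) =
          ∫ w, f w ∂(PathSpace.shiftMeasure s R : Measure (PathSpace X)) := by
      intro R
      rw [PathSpace.integral_shiftMeasure, PathSpace.cylinderFn_perm hperm,
        PathSpace.cylinderFn_cons]
      refine integral_congr_ae (ae_of_all _ fun w => ?_)
      change φ (w s) * PathSpace.cylinderFn L' w = φ (w (s + 0)) * G (PathSpace.shift s w)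
      rw [PathSpace.cylinderFn_shift hmin', add_zero]
    rw [hLf, hLf]
    rcases eq_or_lt_of_le (zero_le (a := s)) with h0 | hs
    · have hid : ∀ w : PathSpace X, PathSpace.shift s w = w := fun w => by
        ext t
        rw [PathSpace.shift_apply, ← h0, zero_add]
      simp only [PathSpace.integral_shiftMeasure, hid]
      exact hf x P hP Q hQ
    · have hev : Measurable fun w : PathSpace X => w s := (continuous_eval_const s).measurable
      have hmap : ∀ R : ProbabilityMeasure (PathSpace X),
          ∫ w, supportFn C (w s) f ∂(R : Measure (PathSpace X)) =
            ∫ y, supportFn C y f ∂((R : Measure (PathSpace X)).map fun w => w s) := fun R =>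
        (integral_map hev.aemeasurable (hC.measurable_supportFn f).aestronglyMeasurable).symm
      rw [integral_eq_of_mem_krylovK hC (hshift x s hs P hP) hf,
        integral_eq_of_mem_krylovK hC (hshift x s hs Q hQ) hf, hmap, hmap, hmarg x P hP Q hQ]

/-- A selection of a map with one-point values is Markov. -/
theorem isMarkovSelection_of_subsingleton {D : X → Set (ProbabilityMeasure (PathSpace X))}
    (hD : IsMeasurableCompactValued D) (hDC : ∀ x, D x ⊆ C x)
    (hsub : ∀ x, (D x).Subsingleton)
    (hshift : ∀ x, ∀ s : ℝ≥0, 0 < s → ∀ P ∈ D x, PathSpace.shiftMeasure s P ∈ krylovK D P s)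
    {p : X → ProbabilityMeasure (PathSpace X)} (hp : ∀ x, p x ∈ D x) : IsMarkovSelection C p := by
  have hmeas := hD.measurable_of_subsingleton hsub hp
  have hmeas' := measurable_toMeasure_of_measurable_borel hmeas
  refine ⟨hmeas, fun x => hDC x (hp x), fun x s hs A hA => ?_⟩
  rw [← mixture_apply hmeas' (p x) s hA]
  congr 1
  refine ext_of_forall_integral_eq_of_IsFiniteMeasure fun f => ?_
  rw [integral_mixture, integral_eq_of_mem_krylovK hD (hshift x s hs (p x) (hp x))
    fun y R hR R' hR' => by rw [hsub y hR hR']]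
  refine integral_congr_ae (ae_of_all _ fun w => ?_)
  exact supportFn_eq_of_forall_eq (hp (w s)) fun R hR => by rw [hsub _ hR (hp (w s))]

end Krylov

theorem mainTheorem2 {X : Type*} [TopologicalSpace X] [PolishSpace X] [MeasurableSpace X]
    [BorelSpace X]
    (Φ : Set (X →ᵇ ℝ)) (hΦ_countable : Φ.Countable) (hΦ_sep : StronglySeparatesPoints Φ)
    (hΦ_mul : ∀ φ ∈ Φ, ∀ ψ ∈ Φ, φ * ψ ∈ Φ)
    (Λ : Set ℝ) (hΛ_countable : Λ.Countable) (hΛ_pos : Λ ⊆ Set.Ioi 0)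
    (hΛ_dense : Set.Ioi 0 ⊆ closure Λ)
    (C : X → Set (ProbabilityMeasure (PathSpace X))) (hC : IsKrylovMap Λ Φ C) :
    ∃ p : X → ProbabilityMeasure (PathSpace X), IsMarkovSelection C p := by
  have hsep : ∀ x y : X, (∀ φ ∈ Φ, φ x = φ y) → x = y := fun x y h => hΦ_sep.eq_of_forall_eq h
  obtain ⟨F, hF⟩ := PathSpace.exists_seq_determining hΦ_countable hsep
  -- `Φ` may be empty; the functional of `φ = 0` is trivial, and adding it allows an enumeration
  let I : Set (ℝ × (X →ᵇ ℝ)) := Λ ×ˢ insert 0 Φ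
  have hI_pos : ∀ i ∈ I, 0 < i.1 := fun i hi => hΛ_pos hi.1
  have hΛ_ne : Λ.Nonempty := by
    rw [← closure_nonempty_iff]
    exact ⟨1, hΛ_dense (mem_Ioi.mpr one_pos)⟩
  have hI_ne : I.Nonempty := hΛ_ne.prod (insert_nonempty _ _)
  obtain ⟨e, he⟩ := (hΛ_countable.prod (hΦ_countable.insert 0)).exists_eq_range hI_ne
  have heI : ∀ n, e n ∈ I := fun n => by
    change e n ∈ Λ ×ˢ insert 0 Φ
    rw [he]
    exact mem_range_self n
  have hCw : IsWeakKrylov I C :=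
    { nonempty := hC.nonempty
      isCompact := hC.isCompact
      measurableSet := hC.measurable
      shift_mem := hC.shift_mem
      exists_shift_eq := by
        intro x s hs P hP Q hQ
        rw [← hC.shift_image_gamma x s hs P hP] at hQ
        obtain ⟨R, ⟨hR, -, hRle⟩, hReq⟩ := hQ
        refine ⟨R, hR, hReq, ?_⟩
        rintro ⟨lam, φ⟩ ⟨hlam, rfl | hφ⟩
        · simp [zetaTrunc]
        · exact hRle lam hlam φ hφ }
  let z : ℕ → PathSpace X →ᵇ ℝ := fun n =>
    PathSpace.discountedFn (e n).1 (hI_pos _ (heI n)) (e n).2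
  let g : ℕ → ProbabilityMeasure (PathSpace X) → ℝ := fun n P =>
    ∫ w, z n w ∂(P : Measure (PathSpace X))
  have hK : ∀ n, IsWeakKrylov I (iterArgmax C g n) := by
    intro n
    induction n with
    | zero => exact hCw
    | succ n ih => exact ih.maximizers hF (hI_pos _ (heI n)) (heI n)
  let D : X → Set (ProbabilityMeasure (PathSpace X)) := fun x => ⋂ n, iterArgmax C g n x
  have hDC : ∀ x, D x ⊆ C x := fun x => iInter_subset _ 0
  have hM : ∀ n, IsMeasurableCompactValued (iterArgmax C g n) := fun n =>
    (hK n).toIsMeasurableCompactValued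
  have hD : IsMeasurableCompactValued D :=
    IsMeasurableCompactValued.iInter hM (iterArgmax_succ_subset C g)
  have hshift : ∀ x, ∀ s : ℝ≥0, 0 < s → ∀ P ∈ D x,
      PathSpace.shiftMeasure s P ∈ krylovK D P s := fun x s hs P hP =>
    shift_mem_krylovK_iInter hM (iterArgmax_succ_subset C g) fun n =>
      (hK n).shift_mem x s hs P (mem_iInter.mp hP n)
  have hmarg : ∀ x, ∀ P ∈ D x, ∀ Q ∈ D x, ∀ t : ℝ≥0,
      (P : Measure (PathSpace X)).map (fun w => w t) =
        (Q : Measure (PathSpace X)).map (fun w => w t) := by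
    intro x P hP Q hQ t
    refine PathSpace.map_eval_eq_of_integral_discountedFn_eq hsep hΦ_mul hΛ_pos hΛ_dense
      (fun lam hlam φ hφ => ?_) t
    have hmem : (lam, φ) ∈ Λ ×ˢ insert 0 Φ := ⟨hlam, mem_insert_of_mem _ hφ⟩
    rw [he] at hmem
    obtain ⟨n, hn⟩ := hmem
    have h := eq_of_mem_iInter_iterArgmax hP hQ n
    simp only [g, z, hn] at h
    exact h
  have hsub : ∀ x, (D x).Subsingleton := fun x P hP Q hQ =>
    PathSpace.ext_of_integral_cylinderFn_eq hsep dense_univ fun L _ =>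
      integral_cylinderFn_eq hD (fun y R hR => hC.supported y R (hDC y hR)) hshift hmarg
        L.length L rfl x P hP Q hQ
  choose p hp using hD.nonempty
  exact ⟨p, isMarkovSelection_of_subsingleton hD hDC hsub hshift hp⟩
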